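/- **Corollary 3.3 (decidability of bounded-height tree duality).** Digraphs are finite and may have loops and pairs of opposite arcs; write $G\to H$ if there is a homomorphism from $G$ to $H$. A set $\mathcal F$ of digraphs is a *complete set of obstructions* for a digraph $H$ if for every digraph $G$ we have $G\to H$ if and only if there is no $F\in\mathcal F$ with $F\to G$. An *oriented tree* is a digraph obtained by orienting every edge of a finite undirected tree in one direction, and its *algebraic height* is the minimum number of arcs of a directed path to which it admits a homomorphism. A digraph $H$ has *bounded-height tree duality* if there is a constant $m$ such that $H$ has a complete set of obstructions consisting of oriented trees of algebraic height at most $m$. The problem whether an input digraph $H$ (given by its number $n$ of vertices and a list of its arcs, the vertices being $0,\dots,n-1$) has bounded-height tree duality is decidable, i.e. there is an algorithm that halts on every input and answers correctly. -/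

import Mathlib

namespace BoundedHeightTreeDuality

/-- `G → H`: there is a homomorphism from the digraph `G` to the digraph `H`, that is, a map of
vertices that sends every arc of `G` to an arc of `H`. Loops and pairs of opposite arcs are
allowed in digraphs. -/
def HomTo {V W : Type} (G : Digraph V) (H : Digraph W) : Prop :=
  ∃ f : V → W, ∀ u v : V, G.Adj u v → H.Adj (f u) (f v)

/-- A bundled finite digraph; used to speak about sets of finite digraphs. -/
structure FinDigraph where
  /-- The vertex set. -/
  Vert : Type
  /-- There are finitely many vertices. -/
  finite : Finite Vert
  /-- The digraph itself. -/
  graph : Digraph Vert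

/-- An oriented tree: an orientation of an undirected tree. There is no loop and no pair of
opposite arcs, and the underlying undirected graph is a tree (connected, in particular nonempty,
and acyclic). -/
def IsOrientedTree {V : Type} (T : Digraph V) : Prop :=
  (∀ u v : V, T.Adj u v → ¬ T.Adj v u) ∧ T.toSimpleGraphInclusive.IsTree

/-- The directed path with `n` arcs `0 → 1 → ⋯ → n`. -/
def directedPath (n : ℕ) : Digraph (Fin (n + 1)) where
  Adj i j := (i : ℕ) + 1 = (j : ℕ)

/-- The algebraic height: the minimum number of arcs of a directed path to which `T` maps
homomorphically (and `⊤` if there is no such path, which does not happen for finite oriented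
trees). -/
noncomputable def algebraicHeight {V : Type} (T : Digraph V) : ℕ∞ :=
  ⨅ (n : ℕ) (_ : HomTo T (directedPath n)), (n : ℕ∞)

/-- `F` is a complete set of obstructions for `H`: a finite digraph `G` maps to `H` if and only
if no member of `F` maps to `G`. -/
def IsCompleteObstructionSet (F : Set FinDigraph) {W : Type} (H : Digraph W) : Prop :=
  ∀ G : FinDigraph, HomTo G.graph H ↔ ∀ T ∈ F, ¬ HomTo T.graph G.graph

/-- `H` has bounded-height tree duality: for some constant `m`, it has a complete set of
obstructions consisting of oriented trees of algebraic height at most `m`. -/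
def HasBoundedHeightTreeDuality {W : Type} (H : Digraph W) : Prop :=
  ∃ m : ℕ, ∃ F : Set FinDigraph,
    (∀ T ∈ F, IsOrientedTree T.graph ∧ algebraicHeight T.graph ≤ (m : ℕ∞)) ∧
      IsCompleteObstructionSet F H

/-- The input format for digraphs: the number `n` of vertices together with a list of arcs.
The vertices are `0, …, n - 1`. -/
abbrev DigraphCode : Type := ℕ × List (ℕ × ℕ)

/-- The digraph on `{0, …, n - 1}` described by a code `(n, L)`: there is an arc from `u` to `v`
exactly when `(u, v)` occurs in the list `L` (entries of `L` that are not pairs of vertices are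
ignored). Every finite digraph is isomorphic to one of this form. -/
def decode (c : DigraphCode) : Digraph (Fin c.1) where
  Adj u v := ((u : ℕ), (v : ℕ)) ∈ c.2

end BoundedHeightTreeDuality

/-
The power digraph `P(H)` has the nonempty vertex sets of `H` as vertices. An oriented tree maps to
`H` if it maps to `P(H)`, because a homomorphism can be selected vertex by vertex from the root;
conversely, if every oriented tree that maps to `G` also maps to `H`, then arc consistency yields
`G → P(H)`. As a tree has height at most `m` exactly when it maps to the directed path `P_m`,
bounded-height tree duality with bound `m` says that `G × P_m → P(H)` implies `G → H`, and this
holds for all `G` if and only if `P(H) → H` and `H ^ P_m → H`.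

It remains to bound `m`. Applied to the sequences `(a, …, a, b, …, b)`, a homomorphism
`H ^ P_m → H` becomes a walk of length `m + 1` in `H ^ (H × H)` from `φ ∘ snd` to `φ ∘ fst`. The
walk can be shortened to at most `N = |H| ^ (|H| * |H|)` steps, and evaluating it along two
consecutive windows of length `N` of a walk in `H` gives closed walks, hence `H ^ P_{2N} → P(H)`.
So `H` has bounded-height tree duality if and only if `P(H) → H` and `H ^ P_{2N} → H`, which is a
bounded search.
-/

namespace BoundedHeightTreeDuality

section Homomorphisms

variable {U V W X : Type}

theorem HomTo.refl (G : Digraph V) : HomTo G G := ⟨id, fun _ _ h => h⟩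

theorem HomTo.trans {F : Digraph U} {G : Digraph V} {H : Digraph W} :
    HomTo F G → HomTo G H → HomTo F H
  | ⟨f, hf⟩, ⟨g, hg⟩ => ⟨g ∘ f, fun _ _ h => hg _ _ (hf _ _ h)⟩

theorem homTo_iff_of_surjective {G : Digraph V} {H : Digraph W} {e : U → V}
    (he : e.Surjective) :
    HomTo G H ↔ ∃ f : U → W, ∀ u v, G.Adj (e u) (e v) → H.Adj (f u) (f v) := by
  refine ⟨fun ⟨f, hf⟩ => ⟨f ∘ e, fun u v => hf (e u) (e v)⟩, fun ⟨f, hf⟩ => ?_⟩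
  refine ⟨f ∘ Function.surjInv he, fun u v huv => hf _ _ ?_⟩
  simpa only [Function.surjInv_eq] using huv

/-- The categorical product of two digraphs. -/
def prodDigraph (G : Digraph V) (K : Digraph X) : Digraph (V × X) where
  Adj p q := G.Adj p.1 q.1 ∧ K.Adj p.2 q.2

theorem homTo_prodDigraph_iff {T : Digraph U} {G : Digraph V} {K : Digraph X} :
    HomTo T (prodDigraph G K) ↔ HomTo T G ∧ HomTo T K :=
  ⟨fun ⟨f, hf⟩ => ⟨⟨fun u => (f u).1, fun u v h => (hf u v h).1⟩,
      ⟨fun u => (f u).2, fun u v h => (hf u v h).2⟩⟩,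
    fun ⟨⟨f, hf⟩, ⟨g, hg⟩⟩ => ⟨fun u => (f u, g u), fun u v h => ⟨hf u v h, hg u v h⟩⟩⟩

/-- The exponential digraph `H ^ K`, right adjoint to the product with `K`. Its vertices are all
maps from `K` to `H`, not only the homomorphisms. -/
def expDigraph (H : Digraph W) (K : Digraph X) : Digraph (X → W) where
  Adj f g := ∀ x y, K.Adj x y → H.Adj (f x) (g y)

theorem homTo_expDigraph_iff {G : Digraph V} {H : Digraph W} {K : Digraph X} :
    HomTo G (expDigraph H K) ↔ HomTo (prodDigraph G K) H :=
  ⟨fun ⟨f, hf⟩ => ⟨fun p => f p.1 p.2, fun _ _ h => hf _ _ h.1 _ _ h.2⟩,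
    fun ⟨f, hf⟩ => ⟨fun v x => f (v, x), fun _ _ h _ _ hxy => hf _ _ ⟨h, hxy⟩⟩⟩

theorem homTo_expDigraph_of_homTo (H : Digraph W) {K : Digraph X} {L : Digraph V}
    (h : HomTo K L) : HomTo (expDigraph H L) (expDigraph H K) :=
  let ⟨f, hf⟩ := h
  ⟨fun g => g ∘ f, fun _ _ hgg _ _ hxy => hgg _ _ (hf _ _ hxy)⟩

theorem homTo_directedPath_of_le {m n : ℕ} (h : m ≤ n) :
    HomTo (directedPath m) (directedPath n) :=
  ⟨Fin.castLE (by lia), fun _ _ huv => huv⟩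

theorem algebraicHeight_le_iff {T : Digraph V} {m : ℕ} :
    algebraicHeight T ≤ m ↔ HomTo T (directedPath m) := by
  refine ⟨fun h => ?_, fun h => iInf₂_le m h⟩
  have hlt : algebraicHeight T < (m + 1 : ℕ) := h.trans_lt (by exact_mod_cast m.lt_succ_self)
  obtain ⟨n, hn, hnm⟩ := by simpa only [algebraicHeight, iInf_lt_iff] using hlt
  exact hn.trans (homTo_directedPath_of_le (Nat.lt_succ_iff.1 (by exact_mod_cast hnm)))

/-- The arcs of the power digraph. -/
def SetArc (H : Digraph W) (A B : Set W) : Prop :=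
  (∀ a ∈ A, ∃ b ∈ B, H.Adj a b) ∧ ∀ b ∈ B, ∃ a ∈ A, H.Adj a b

/-- The power digraph of `H`, whose vertices are the nonempty vertex sets of `H`. -/
def powerDigraph (H : Digraph W) : Digraph {A : Set W // A.Nonempty} where
  Adj A B := SetArc H A B

theorem homTo_powerDigraph (H : Digraph W) : HomTo H (powerDigraph H) :=
  ⟨fun w => ⟨{w}, Set.singleton_nonempty w⟩, fun _ _ h => by simpa [powerDigraph, SetArc] using h⟩

end Homomorphisms

section TreesIntoPowerDigraph

theorem exists_solution_of_isTree {V W : Type*} [Finite V] {K : SimpleGraph V} (hK : K.IsTree)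
    {A : V → Set W} (hA : ∀ v, (A v).Nonempty) {R : V → V → W → W → Prop}
    (hsymm : ∀ u v a b, R u v a b → R v u b a)
    (hR : ∀ u v, K.Adj u v → ∀ a ∈ A u, ∃ b ∈ A v, R u v a b) :
    ∃ g : V → W, (∀ v, g v ∈ A v) ∧ ∀ u v, K.Adj u v → R u v (g u) (g v) := by
  classical
  induction hn : Nat.card V generalizing V with
  | zero =>
    have := hK.connected.nonempty
    exact absurd hn Nat.card_pos.ne'
  | succ n ih =>
    have := Fintype.ofFinite V
    rcases subsingleton_or_nontrivial V with _ | _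
    · choose g hg using hA
      exact ⟨g, hg, fun u v huv => absurd (Subsingleton.elim u v) huv.ne⟩
    obtain ⟨v, hv⟩ := hK.exists_vert_degree_one_of_nontrivial
    obtain ⟨u, hvu, hu⟩ := SimpleGraph.degree_eq_one_iff_existsUnique_adj.1 hv
    have hcard : Nat.card ({v}ᶜ : Set V) = n := by
      have := Set.ncard_add_ncard_compl {v}
      rw [Set.ncard_singleton] at this
      rw [Nat.card_coe_set_eq]
      lia
    obtain ⟨g, hgA, hgR⟩ := ih (K := K.induce {v}ᶜ)
      ⟨hK.connected.induce_compl_singleton_of_degree_eq_one hv, hK.isAcyclic.induce _⟩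
      (fun x => hA x) (fun x y => hsymm x y) (fun x y => hR x y) hcard
    obtain ⟨b, hbA, hbR⟩ := hR u v hvu.symm _ (hgA ⟨u, hvu.ne'⟩)
    refine ⟨fun x => if hx : x = v then b else g ⟨x, hx⟩, fun x => ?_, fun x y hxy => ?_⟩
    · by_cases hx : x = v
      · simpa [hx] using hbA
      · simpa [hx] using hgA ⟨x, hx⟩
    · rcases eq_or_ne x v with rfl | hx
      · obtain rfl := hu y hxy
        simpa [hxy.ne'] using hsymm _ _ _ _ hbR
      rcases eq_or_ne y v with rfl | hy
      · obtain rfl := hu x hxy.symm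
        simpa [hx] using hbR
      · simpa [hx, hy] using hgR ⟨x, hx⟩ ⟨y, hy⟩ hxy

variable {V W : Type}

theorem IsOrientedTree.homTo_of_homTo_powerDigraph [Finite V] {T : Digraph V} {H : Digraph W}
    (hT : IsOrientedTree T) (h : HomTo T (powerDigraph H)) : HomTo T H := by
  obtain ⟨A, hA⟩ := h
  have hne : ∀ u v, T.Adj u v → u ≠ v := fun u v huv => by
    rintro rfl
    exact hT.1 u u huv huv
  have hlift : ∀ u v, T.toSimpleGraphInclusive.Adj u v → ∀ a ∈ (A u).1, ∃ b ∈ (A v).1,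
      (T.Adj u v → H.Adj a b) ∧ (T.Adj v u → H.Adj b a) := by
    rintro u v ⟨-, huv | hvu⟩ a ha
    · obtain ⟨b, hb, hab⟩ := (hA u v huv).1 a ha
      exact ⟨b, hb, fun _ => hab, fun hvu => absurd hvu (hT.1 u v huv)⟩
    · obtain ⟨b, hb, hba⟩ := (hA v u hvu).2 a ha
      exact ⟨b, hb, fun huv => absurd huv (hT.1 v u hvu), fun _ => hba⟩
  obtain ⟨g, -, hg⟩ := exists_solution_of_isTree hT.2 (fun v => (A v).2)
    (fun _ _ _ _ => And.symm) hlift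
  exact ⟨g, fun u v huv => (hg u v ⟨hne u v huv, .inl huv⟩).1 huv⟩

end TreesIntoPowerDigraph

section RootedTrees

variable {U V W X : Type}

/-- Adjacency along an arc that is traversed forwards (`true`) or backwards (`false`). -/
def DirAdj (G : Digraph V) : Bool → V → V → Prop
  | true, x, y => G.Adj x y
  | false, x, y => G.Adj y x

/-- The disjoint union of `T` and `C` with one more arc, between `r` and `c`; it leaves `r` if
`d = true` and enters `r` if `d = false`. -/
def graftDigraph (T : Digraph V) (r : V) (d : Bool) (C : Digraph U) (c : U) :
    Digraph (V ⊕ U) where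
  Adj
    | .inl x, .inl y => T.Adj x y
    | .inr x, .inr y => C.Adj x y
    | .inl x, .inr y => d = true ∧ x = r ∧ y = c
    | .inr y, .inl x => d = false ∧ x = r ∧ y = c

theorem isTree_sum_sup_edge {V U : Type*} [Finite V] [Finite U] {G : SimpleGraph V}
    {K : SimpleGraph U} (hG : G.IsTree) (hK : K.IsTree) (v : V) (u : U) :
    ((G ⊕g K) ⊔ SimpleGraph.edge (.inl v) (.inr u)).IsTree := by
  rw [SimpleGraph.isTree_iff_connected_and_card] at hG hK ⊢
  refine ⟨hG.1.sum_sup_edge hK.1, ?_⟩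
  have hdisj : Disjoint (G ⊕g K).edgeSet {s(.inl v, .inr u)} := by
    simp [Set.disjoint_singleton_right]
  rw [SimpleGraph.edgeSet_sup, SimpleGraph.edgeSet_edge_of_ne (by simp), Nat.card_coe_set_eq,
    Set.ncard_union_eq hdisj, Set.ncard_singleton, ← Nat.card_coe_set_eq,
    Nat.card_congr SimpleGraph.edgeSetSumEquiv, Nat.card_sum, Nat.card_sum]
  lia

theorem isOrientedTree_graftDigraph [Finite V] [Finite U] {T : Digraph V} {C : Digraph U}
    (hT : IsOrientedTree T) (hC : IsOrientedTree C) (r : V) (d : Bool) (c : U) :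
    IsOrientedTree (graftDigraph T r d C c) := by
  constructor
  · rintro (x | x) (y | y) h
    · exact hT.1 x y h
    · rintro ⟨h', -⟩
      simp_all [graftDigraph]
    · rintro ⟨h', -⟩
      simp_all [graftDigraph]
    · exact hC.1 x y h
  · convert isTree_sum_sup_edge hT.2 hC.2 r c
    ext x y
    rcases x with x | x <;> rcases y with y | y <;> cases d <;>
      simp [Digraph.toSimpleGraphInclusive, graftDigraph, SimpleGraph.edge_adj] <;> tauto

/-- Rooted oriented trees, as terms: `graft t d c` joins the roots of `t` and `c` by an arc, which
leaves the root of `t` if and only if `d = true`, and keeps the root of `t`. -/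
inductive RootedTree : Type
  | leaf : RootedTree
  | graft (t : RootedTree) (d : Bool) (c : RootedTree) : RootedTree

namespace RootedTree

/-- The vertices of a rooted tree. -/
def Vert : RootedTree → Type
  | leaf => Unit
  | graft t _ c => t.Vert ⊕ c.Vert

/-- The root of a rooted tree. -/
def root : (t : RootedTree) → t.Vert
  | leaf => ()
  | graft t _ _ => .inl t.root

/-- The oriented tree underlying a rooted tree. -/
def graph : (t : RootedTree) → Digraph t.Vert
  | leaf => ⟨fun _ _ => False⟩
  | graft t d c => graftDigraph t.graph t.root d c.graph c.root

theorem finite_vert : ∀ t : RootedTree, Finite t.Vert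
  | leaf => inferInstanceAs (Finite Unit)
  | graft t _ c =>
    have := t.finite_vert
    have := c.finite_vert
    inferInstanceAs (Finite (t.Vert ⊕ c.Vert))

theorem isOrientedTree_graph : ∀ t : RootedTree, IsOrientedTree t.graph
  | leaf => ⟨fun _ _ h => h.elim, .of_subsingleton (V := Unit)⟩
  | graft t d c =>
    have := t.finite_vert
    have := c.finite_vert
    isOrientedTree_graftDigraph t.isOrientedTree_graph c.isOrientedTree_graph t.root d c.root

/-- `t.MapsTo G x`: some homomorphism from `t` to `G` sends the root to `x`. -/
def MapsTo (t : RootedTree) (G : Digraph V) (x : V) : Prop :=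
  ∃ f : t.Vert → V, (∀ u v, t.graph.Adj u v → G.Adj (f u) (f v)) ∧ f t.root = x

theorem mapsTo_leaf (G : Digraph V) (x : V) : leaf.MapsTo G x :=
  ⟨fun _ => x, fun _ _ h => h.elim, rfl⟩

theorem mapsTo_graft {G : Digraph V} {t c : RootedTree} {d : Bool} {x : V} :
    (graft t d c).MapsTo G x ↔ t.MapsTo G x ∧ ∃ y, DirAdj G d x y ∧ c.MapsTo G y := by
  constructor
  · rintro ⟨f, hf, rfl⟩
    refine ⟨⟨f ∘ .inl, fun u v => hf (.inl u) (.inl v), rfl⟩, f (.inr c.root), ?_,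
      f ∘ .inr, fun u v => hf (.inr u) (.inr v), rfl⟩
    cases d
    · exact hf (.inr c.root) (.inl t.root) ⟨rfl, rfl, rfl⟩
    · exact hf (.inl t.root) (.inr c.root) ⟨rfl, rfl, rfl⟩
  · rintro ⟨⟨f, hf, rfl⟩, _, harc, g, hg, rfl⟩
    refine ⟨Sum.elim f g, ?_, rfl⟩
    rintro (u | u) (v | v) huv
    · exact hf u v huv
    · obtain ⟨rfl, rfl, rfl⟩ := huv
      exact harc
    · obtain ⟨rfl, rfl, rfl⟩ := huv
      exact harc
    · exact hg u v huv

/-- Identifies the roots of two trees. -/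
def glue (s : RootedTree) : RootedTree → RootedTree
  | leaf => s
  | graft t d c => graft (s.glue t) d c

theorem mapsTo_glue {G : Digraph V} {s t : RootedTree} {x : V} :
    (s.glue t).MapsTo G x ↔ s.MapsTo G x ∧ t.MapsTo G x := by
  induction t with
  | leaf => simp only [glue, mapsTo_leaf, and_true]
  | graft t d c iht => simp only [glue, mapsTo_graft, iht, and_assoc]

end RootedTree

/-- The vertices of `H` to which arc consistency allows the vertex `x` of `G` to be sent: no rooted
tree tells them apart from `x`. -/
def consistentSet (G : Digraph V) (H : Digraph W) (x : V) : Set W :=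
  {w | ∀ t : RootedTree, t.MapsTo G x → t.MapsTo H w}

theorem exists_mapsTo_forall_not_mapsTo {G : Digraph V} {H : Digraph W} {x : V} {S : Set W}
    (hS : S.Finite) (hdisj : ∀ w ∈ S, w ∉ consistentSet G H x) :
    ∃ t : RootedTree, t.MapsTo G x ∧ ∀ w ∈ S, ¬ t.MapsTo H w := by
  induction S, hS using Set.Finite.induction_on with
  | empty => exact ⟨.leaf, RootedTree.mapsTo_leaf G x, fun _ => False.elim⟩
  | @insert a S _ _ ih =>
    rw [Set.forall_mem_insert] at hdisj
    obtain ⟨t, htG, htH⟩ := ih hdisj.2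
    obtain ⟨s, hsG, hsH⟩ : ∃ s : RootedTree, s.MapsTo G x ∧ ¬ s.MapsTo H a := by
      simpa [consistentSet] using hdisj.1
    refine ⟨s.glue t, RootedTree.mapsTo_glue.2 ⟨hsG, htG⟩, ?_⟩
    simp only [RootedTree.mapsTo_glue]
    rintro w (rfl | hw) ⟨hs, ht⟩
    exacts [hsH hs, htH w hw ht]

variable [Finite W]

theorem exists_mem_consistentSet_of_dirAdj {G : Digraph V} {H : Digraph W} {d : Bool} {x y : V}
    (hxy : DirAdj G d x y) {a : W} (ha : a ∈ consistentSet G H x) :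
    ∃ b ∈ consistentSet G H y, DirAdj H d a b := by
  by_contra! hcon
  obtain ⟨t, htG, htH⟩ := exists_mapsTo_forall_not_mapsTo (Set.toFinite {b | DirAdj H d a b})
    fun b hb hmem => hcon b hmem hb
  have hgraft : (RootedTree.leaf.graft d t).MapsTo H a :=
    ha _ (RootedTree.mapsTo_graft.2 ⟨RootedTree.mapsTo_leaf G x, y, hxy, htG⟩)
  obtain ⟨-, b, hab, hb⟩ := RootedTree.mapsTo_graft.1 hgraft
  exact htH b hab hb

theorem homTo_powerDigraph_of_forall_isOrientedTree {G : Digraph V} {H : Digraph W}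
    (h : ∀ T : FinDigraph, IsOrientedTree T.graph → HomTo T.graph G → HomTo T.graph H) :
    HomTo G (powerDigraph H) := by
  have hne : ∀ x, (consistentSet G H x).Nonempty := fun x => by
    by_contra! hempty
    obtain ⟨t, ⟨f, hf, -⟩, htH⟩ :=
      exists_mapsTo_forall_not_mapsTo (G := G) (H := H) (x := x) Set.finite_univ (by simp [hempty])
    obtain ⟨g, hg⟩ := h ⟨t.Vert, t.finite_vert, t.graph⟩ t.isOrientedTree_graph ⟨f, hf⟩
    exact htH (g t.root) trivial ⟨g, hg, rfl⟩
  exact ⟨fun x => ⟨consistentSet G H x, hne x⟩, fun x y hxy =>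
    ⟨fun _ => exists_mem_consistentSet_of_dirAdj (d := true) hxy,
      fun _ => exists_mem_consistentSet_of_dirAdj (d := false) hxy⟩⟩

end RootedTrees

section DualityCriterion

variable {W : Type} [Finite W] {H : Digraph W}

theorem hasBoundedHeightTreeDuality_iff_prodDigraph :
    HasBoundedHeightTreeDuality H ↔ ∃ m : ℕ, ∀ G : FinDigraph,
      HomTo (prodDigraph G.graph (directedPath m)) (powerDigraph H) → HomTo G.graph H := by
  constructor
  · rintro ⟨m, F, hF, hobs⟩
    refine ⟨m, fun G hG => (hobs G).2 fun T hTF hTG => ?_⟩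
    obtain ⟨hT, hTm⟩ := hF T hTF
    have := T.finite
    have hTprod := homTo_prodDigraph_iff.2 ⟨hTG, algebraicHeight_le_iff.1 hTm⟩
    exact (hobs T).1 (hT.homTo_of_homTo_powerDigraph (hTprod.trans hG)) T hTF (.refl _)
  · rintro ⟨m, hm⟩
    refine ⟨m, {T | IsOrientedTree T.graph ∧ algebraicHeight T.graph ≤ m ∧ ¬ HomTo T.graph H},
      fun T hT => ⟨hT.1, hT.2.1⟩, fun G => ⟨fun hG T hT hTG => hT.2.2 (hTG.trans hG), fun hG => ?_⟩⟩
    refine hm G (homTo_powerDigraph_of_forall_isOrientedTree fun T hT hTprod => ?_)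
    obtain ⟨hTG, hTm⟩ := homTo_prodDigraph_iff.1 hTprod
    by_contra hTH
    exact hG T ⟨hT, algebraicHeight_le_iff.2 hTm, hTH⟩ hTG

theorem hasBoundedHeightTreeDuality_iff_exists_expDigraph :
    HasBoundedHeightTreeDuality H ↔
      HomTo (powerDigraph H) H ∧ ∃ m : ℕ, HomTo (expDigraph H (directedPath m)) H := by
  rw [hasBoundedHeightTreeDuality_iff_prodDigraph]
  constructor
  · rintro ⟨m, hm⟩
    refine ⟨hm ⟨_, inferInstance, powerDigraph H⟩ (homTo_prodDigraph_iff.1 (.refl _)).1, m, ?_⟩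
    exact hm ⟨_, inferInstance, expDigraph H (directedPath m)⟩
      ((homTo_expDigraph_iff.1 (.refl _)).trans (homTo_powerDigraph H))
  · rintro ⟨hpow, m, hm⟩
    exact ⟨m, fun G hG => (homTo_expDigraph_iff.2 (hG.trans hpow)).trans hm⟩

end DualityCriterion

section Walks

variable {V W : Type}

/-- The first `n + 1` terms of `s` form a directed walk of length `n` in `G`. -/
def IsWalk (G : Digraph V) (n : ℕ) (s : ℕ → V) : Prop :=
  ∀ i < n, G.Adj (s i) (s (i + 1))

theorem IsWalk.shortcut {G : Digraph V} {n : ℕ} {s : ℕ → V} (hs : IsWalk G n s) {i j : ℕ}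
    (hij : i < j) (heq : s i = s j) :
    IsWalk G (n - (j - i)) fun k => if k ≤ i then s k else s (k + (j - i)) := by
  intro k hk
  rcases lt_trichotomy k i with hki | rfl | hki
  · simpa [hki.le, Nat.succ_le_of_lt hki] using hs k (by lia)
  · simpa [heq, show k + 1 + (j - k) = j + 1 by lia] using hs j (by lia)
  · simpa [hki.not_ge, show ¬ k + 1 ≤ i by lia, show k + 1 + (j - i) = k + (j - i) + 1 by lia]
      using hs (k + (j - i)) (by lia)

theorem IsWalk.exists_length_le_card [Finite V] {G : Digraph V} {n : ℕ} {s : ℕ → V}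
    (hs : IsWalk G n s) (hn : 0 < n) :
    ∃ n' s', 0 < n' ∧ n' ≤ Nat.card V ∧ IsWalk G n' s' ∧ s' 0 = s 0 ∧ s' n' = s n := by
  have := Fintype.ofFinite V
  rw [Nat.card_eq_fintype_card]
  induction n using Nat.strong_induction_on generalizing s with
  | _ n ih =>
    rcases le_or_gt n (Fintype.card V) with hle | hlt
    · exact ⟨n, s, hn, hle, hs, rfl, rfl⟩
    obtain ⟨i, j, hij, heq⟩ : ∃ i j : Fin n, i < j ∧ s i = s j := by
      obtain ⟨i, j, hne, heq⟩ := Fintype.exists_ne_map_eq_of_card_lt (fun i : Fin n => s i)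
        (by simpa using hlt)
      rcases hne.lt_or_gt with h | h
      exacts [⟨i, j, h, heq⟩, ⟨j, i, h, heq.symm⟩]
    have hij : (i : ℕ) < j := hij
    obtain ⟨n', s', hpos, hcard, hwalk, hfirst, hlast⟩ :=
      ih (n - (j - i)) (by lia) (hs.shortcut hij heq) (by lia)
    refine ⟨n', s', hpos, hcard, hwalk, by simpa using hfirst, hlast.trans ?_⟩
    simp [show ¬ n - (j - i) ≤ (i : ℕ) by lia, show n - (j - i) + (j - i) = n by lia]

theorem isWalk_directedPath (n : ℕ) : IsWalk (directedPath n) n (Fin.ofNat (n + 1)) := by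
  intro i hi
  simp [directedPath, Nat.mod_eq_of_lt, hi, hi.trans]

theorem homTo_powerDigraph_of_isWalk_expDigraph {G : Digraph V} {H : Digraph W} {n : ℕ}
    {χ : ℕ → V → W} (hχ : IsWalk (expDigraph H G) n χ) (hn : 0 < n) (hclosed : χ n = χ 0) :
    HomTo G (powerDigraph H) := by
  refine ⟨fun v => ⟨(χ · v) '' Set.Iio n, χ 0 v, 0, hn, rfl⟩, fun u v huv => ⟨?_, ?_⟩⟩
  · rintro _ ⟨i, hi, rfl⟩
    refine ⟨χ (i + 1) v, ?_, hχ i hi u v huv⟩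
    rcases (Nat.succ_le_of_lt hi).lt_or_eq with hlt | rfl
    · exact ⟨i + 1, hlt, rfl⟩
    · exact ⟨0, hn, by rw [hclosed]⟩
  · suffices h : ∀ j ≤ n, 0 < j → ∃ a ∈ (χ · u) '' Set.Iio n, H.Adj a (χ j v) by
      rintro _ ⟨j, hj, rfl⟩
      rcases j.eq_zero_or_pos with rfl | hpos
      · simpa only [hclosed] using h n le_rfl hn
      · exact h j (le_of_lt hj) hpos
    rintro (_ | i) hi hpos
    · exact absurd hpos (lt_irrefl 0)
    · exact ⟨_, ⟨i, hi, rfl⟩, hχ i hi u v huv⟩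

theorem exists_isWalk_of_homTo_expDigraph {H : Digraph W} {m : ℕ}
    (h : HomTo (expDigraph H (directedPath m)) H) :
    ∃ (φ : W → W) (s : ℕ → W × W → W), IsWalk (expDigraph H (prodDigraph H H)) (m + 1) s ∧
      s 0 = φ ∘ Prod.snd ∧ s (m + 1) = φ ∘ Prod.fst := by
  obtain ⟨e, he⟩ := h
  refine ⟨fun a => e fun _ => a, fun k p => e fun i => if (i : ℕ) < k then p.1 else p.2,
    fun k _ p q hpq => he _ _ fun i j hij => ?_, ?_, ?_⟩
  · have hij : (i : ℕ) + 1 = j := hij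
    by_cases hik : (i : ℕ) < k
    · simpa [hik, show (j : ℕ) < k + 1 by lia] using hpq.1
    · simpa [hik, show ¬ (j : ℕ) < k + 1 by lia] using hpq.2
  · ext p
    simp
  · ext p
    simp [Fin.is_le]

theorem homTo_powerDigraph_of_isWalk {H : Digraph W} {φ : W → W} {n : ℕ} {s : ℕ → W × W → W}
    (hs : IsWalk (expDigraph H (prodDigraph H H)) n s) (hn : 0 < n) (hfirst : s 0 = φ ∘ Prod.snd)
    (hlast : s n = φ ∘ Prod.fst) :
    HomTo (expDigraph H (directedPath (2 * n))) (powerDigraph H) := by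
  have hpath := isWalk_directedPath (2 * n)
  let x : ℕ → Fin (2 * n + 1) := Fin.ofNat (2 * n + 1)
  refine homTo_powerDigraph_of_isWalk_expDigraph (χ := fun i f => s i (f (x i), f (x (n + i))))
    (fun i hi f g hfg => ?_) hn ?_
  · exact hs i hi _ _ ⟨hfg _ _ (hpath i (by lia)), hfg _ _ (hpath (n + i) (by lia))⟩
  · ext f
    simp [hfirst, hlast]

theorem hasBoundedHeightTreeDuality_iff_expDigraph [Finite W] {H : Digraph W} :
    HasBoundedHeightTreeDuality H ↔ HomTo (powerDigraph H) H ∧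
      HomTo (expDigraph H (directedPath (2 * Nat.card W ^ (Nat.card W * Nat.card W)))) H := by
  rw [hasBoundedHeightTreeDuality_iff_exists_expDigraph]
  refine and_congr_right fun hpow => ⟨fun ⟨m, hm⟩ => ?_, fun h => ⟨_, h⟩⟩
  obtain ⟨φ, s, hs, hfirst, hlast⟩ := exists_isWalk_of_homTo_expDigraph hm
  obtain ⟨n, s', hn, hcard, hs', hfirst', hlast'⟩ := hs.exists_length_le_card m.succ_pos
  rw [Nat.card_fun, Nat.card_prod] at hcard
  have hshort : HomTo (expDigraph H (directedPath (2 * n))) (powerDigraph H) :=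
    homTo_powerDigraph_of_isWalk hs' hn (hfirst'.trans hfirst) (hlast'.trans hlast)
  exact ((homTo_expDigraph_of_homTo H (homTo_directedPath_of_le (by lia))).trans hshort).trans hpow

end Walks

section Decidability

variable {α β : Type*} [Primcodable α] [Primcodable β]

theorem primrecPred_exists_lt {f : α → ℕ} {R : α → ℕ → Prop} (hf : Primrec f)
    (hR : PrimrecRel R) : PrimrecPred fun a => ∃ x < f a, R a x :=
  ((PrimrecRel.exists_mem_list (hR.comp₂ .right .left)).comp (Primrec.list_range.comp hf)
    Primrec.id).of_eq fun a => by simp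

theorem primrecPred_forall_lt {f : α → ℕ} {R : α → ℕ → Prop} (hf : Primrec f)
    (hR : PrimrecRel R) : PrimrecPred fun a => ∀ x < f a, R a x :=
  ((PrimrecRel.forall_mem_list (hR.comp₂ .right .left)).comp (Primrec.list_range.comp hf)
    Primrec.id).of_eq fun a => by simp

theorem primrecPred_imp {p q : α → Prop} (hp : PrimrecPred p) (hq : PrimrecPred q) :
    PrimrecPred fun a => p a → q a :=
  (hp.not.or hq).of_eq fun _ => imp_iff_not_or.symm

theorem primrecRel_mem : PrimrecRel fun (b : β) (L : List β) => b ∈ L :=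
  ((PrimrecRel.exists_mem_list Primrec.eq).comp .snd .fst).of_eq fun p => by simp

theorem primrec₂_pow : Primrec₂ fun m n : ℕ => m ^ n :=
  Primrec₂.unpaired'.1 Nat.Primrec.pow

/-- The `i`-th digit of `x` in base `n`. The numbers below `n ^ k` code the functions
`Fin k → Fin n` by their digits, as in `finFunctionFinEquiv`. -/
def digit (n x i : ℕ) : ℕ := x / n ^ i % n

theorem primrec_digit {n x i : α → ℕ} (hn : Primrec n) (hx : Primrec x) (hi : Primrec i) :
    Primrec fun a => digit (n a) (x a) (i a) :=
  Primrec.nat_mod.comp (Primrec.nat_div.comp hx (primrec₂_pow.comp hn hi)) hn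

/-- The arc relation of `decode c` on the values at `i` and `j` of the functions coded by `x` and
`y`. -/
def DigitArc (c : DigraphCode) (x i y j : ℕ) : Prop :=
  (digit c.1 x i, digit c.1 y j) ∈ c.2

theorem decode_adj_iff_digitArc {c : DigraphCode} {k l : ℕ} {x : Fin (c.1 ^ k)} {i : Fin k}
    {y : Fin (c.1 ^ l)} {j : Fin l} :
    (decode c).Adj (finFunctionFinEquiv.symm x i) (finFunctionFinEquiv.symm y j) ↔
      DigitArc c x i y j := Iff.rfl

theorem primrecPred_digitArc {c : α → DigraphCode} {x i y j : α → ℕ} (hc : Primrec c)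
    (hx : Primrec x) (hi : Primrec i) (hy : Primrec y) (hj : Primrec j) :
    PrimrecPred fun a => DigitArc (c a) (x a) (i a) (y a) (j a) :=
  have hn := Primrec.fst.comp hc
  primrecRel_mem.comp ((primrec_digit hn hx hi).pair (primrec_digit hn hy hj))
    (Primrec.snd.comp hc)

theorem homTo_decode_iff {V : Type} {G : Digraph V} {k : ℕ} {e : Fin k → V} (he : e.Surjective)
    {A : ℕ → ℕ → Prop} (hA : ∀ i j : Fin k, G.Adj (e i) (e j) ↔ A i j) {c : DigraphCode} :
    HomTo G (decode c) ↔ ∃ x < c.1 ^ k, ∀ i < k, ∀ j < k, A i j → DigitArc c x i x j := by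
  simp only [homTo_iff_of_surjective he, finFunctionFinEquiv.symm.surjective.exists, hA,
    decode_adj_iff_digitArc, Fin.exists_iff, Fin.forall_iff, exists_prop]

theorem primrecPred_homTo_decode {V : α → Type} {G : ∀ a, Digraph (V a)} {k : α → ℕ}
    {e : ∀ a, Fin (k a) → V a} {A : α → ℕ → ℕ → Prop} {c : α → DigraphCode} (hc : Primrec c)
    (hk : Primrec k) (he : ∀ a, (e a).Surjective)
    (hA : ∀ a i j, (G a).Adj (e a i) (e a j) ↔ A a i j)
    (hA' : PrimrecPred fun p : α × ℕ × ℕ => A p.1 p.2.1 p.2.2) :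
    PrimrecPred fun a => HomTo (G a) (decode (c a)) := by
  simp only [fun a => homTo_decode_iff (he a) (hA a)]
  have ha : Primrec fun q : ((α × ℕ) × ℕ) × ℕ => q.1.1.1 := .comp .fst (.comp .fst .fst)
  have hx : Primrec fun q : ((α × ℕ) × ℕ) × ℕ => q.1.1.2 := .comp .snd (.comp .fst .fst)
  have hi : Primrec fun q : ((α × ℕ) × ℕ) × ℕ => q.1.2 := .comp .snd .fst
  exact primrecPred_exists_lt (primrec₂_pow.comp (Primrec.fst.comp hc) hk)
    (primrecPred_forall_lt (hk.comp .fst) (primrecPred_forall_lt (hk.comp (.comp .fst .fst))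
      (primrecPred_imp (hA'.comp (ha.pair (hi.pair .snd)))
        (primrecPred_digitArc (hc.comp ha) hx hi hx .snd))))

theorem setArc_range_iff {W : Type} {ι κ : Sort*} {H : Digraph W} {f : ι → W} {g : κ → W} :
    SetArc H (Set.range f) (Set.range g) ↔
      (∀ i, ∃ j, H.Adj (f i) (g j)) ∧ ∀ j, ∃ i, H.Adj (f i) (g j) := by
  simp only [SetArc, Set.forall_mem_range, Set.exists_range_iff]

theorem exists_range_eq {n : ℕ} {A : Set (Fin n)} (hA : A.Nonempty) :
    ∃ f : Fin (n + 1) → Fin n, Set.range f = A := by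
  classical
  obtain ⟨a, ha⟩ := hA
  refine ⟨Fin.cons a fun i => if i ∈ A then i else a, ?_⟩
  rw [Fin.range_cons]
  ext b
  simp only [Set.mem_insert_iff, Set.mem_range]
  grind

/-- The set of values of the function `Fin (n + 1) → Fin n` coded by `x`. Having `n + 1` arguments
rather than `n` keeps it nonempty without excluding `n = 0`. -/
def valueSet {n : ℕ} (x : Fin (n ^ (n + 1))) : {A : Set (Fin n) // A.Nonempty} :=
  ⟨Set.range (finFunctionFinEquiv.symm x), Set.range_nonempty _⟩

theorem valueSet_surjective {n : ℕ} : (valueSet (n := n)).Surjective := fun A => by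
  obtain ⟨f, hf⟩ := exists_range_eq A.2
  exact ⟨finFunctionFinEquiv f, Subtype.ext (by simpa [valueSet] using hf)⟩

theorem powerDigraph_adj_valueSet_iff {c : DigraphCode} {x y : Fin (c.1 ^ (c.1 + 1))} :
    (powerDigraph (decode c)).Adj (valueSet x) (valueSet y) ↔
      (∀ i < c.1 + 1, ∃ j < c.1 + 1, DigitArc c x i y j) ∧
        ∀ j < c.1 + 1, ∃ i < c.1 + 1, DigitArc c x i y j := by
  simp only [powerDigraph, valueSet, setArc_range_iff, decode_adj_iff_digitArc, Fin.exists_iff,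
    Fin.forall_iff, exists_prop]

theorem primrecPred_homTo_powerDigraph :
    PrimrecPred fun c : DigraphCode => HomTo (powerDigraph (decode c)) (decode c) := by
  have hn : Primrec fun c : DigraphCode => c.1 := .fst
  have hn' : Primrec fun c : DigraphCode => c.1 + 1 := Primrec.succ.comp hn
  have hc : Primrec fun q : ((DigraphCode × ℕ × ℕ) × ℕ) × ℕ => q.1.1.1 :=
    .comp .fst (.comp .fst .fst)
  have hx : Primrec fun q : ((DigraphCode × ℕ × ℕ) × ℕ) × ℕ => q.1.1.2.1 :=
    .comp .fst (.comp .snd (.comp .fst .fst))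
  have hy : Primrec fun q : ((DigraphCode × ℕ × ℕ) × ℕ) × ℕ => q.1.1.2.2 :=
    .comp .snd (.comp .snd (.comp .fst .fst))
  have hi : Primrec fun q : ((DigraphCode × ℕ × ℕ) × ℕ) × ℕ => q.1.2 := .comp .snd .fst
  refine primrecPred_homTo_decode (A := fun c x y =>
      (∀ i < c.1 + 1, ∃ j < c.1 + 1, DigitArc c x i y j) ∧
        ∀ j < c.1 + 1, ∃ i < c.1 + 1, DigitArc c x i y j)
    .id (primrec₂_pow.comp hn hn') (fun _ => valueSet_surjective)
    (fun _ _ _ => powerDigraph_adj_valueSet_iff) (.and ?_ ?_)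
  · exact primrecPred_forall_lt (hn'.comp .fst) (primrecPred_exists_lt (hn'.comp (.comp .fst .fst))
      (primrecPred_digitArc hc hx hi hy .snd))
  · exact primrecPred_forall_lt (hn'.comp .fst) (primrecPred_exists_lt (hn'.comp (.comp .fst .fst))
      (primrecPred_digitArc hc hx .snd hy hi))

theorem expDigraph_directedPath_adj_iff {W : Type} {H : Digraph W} {m : ℕ}
    {f g : Fin (m + 1) → W} :
    (expDigraph H (directedPath m)).Adj f g ↔ ∀ i : Fin m, H.Adj (f i.castSucc) (g i.succ) := by
  refine ⟨fun h i => h _ _ (by simp [directedPath]), fun h i j hij => ?_⟩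
  have hij : (i : ℕ) + 1 = j := hij
  have hj : Fin.succ ⟨i, by lia⟩ = j := Fin.ext hij
  exact hj ▸ h ⟨i, by lia⟩

theorem primrecPred_homTo_expDigraph_directedPath {m : DigraphCode → ℕ} (hm : Primrec m) :
    PrimrecPred fun c => HomTo (expDigraph (decode c) (directedPath (m c))) (decode c) := by
  have hn : Primrec fun c : DigraphCode => c.1 := .fst
  have hx : Primrec fun q : (DigraphCode × ℕ × ℕ) × ℕ => q.1.2.1 := .comp .fst (.comp .snd .fst)
  have hy : Primrec fun q : (DigraphCode × ℕ × ℕ) × ℕ => q.1.2.2 := .comp .snd (.comp .snd .fst)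
  refine primrecPred_homTo_decode (A := fun c x y => ∀ i < m c, DigitArc c x i y (i + 1))
    .id (primrec₂_pow.comp hn (Primrec.succ.comp hm))
    (fun _ => finFunctionFinEquiv.symm.surjective) (fun c x y => ?_) ?_
  · simp only [expDigraph_directedPath_adj_iff, decode_adj_iff_digitArc, Fin.forall_iff]
    rfl
  · exact primrecPred_forall_lt (hm.comp .fst)
      (primrecPred_digitArc (.comp .fst .fst) hx .snd hy (Primrec.succ.comp .snd))

end Decidability

end BoundedHeightTreeDuality

theorem corollary3p3_general :
    PrimrecPred fun c : BoundedHeightTreeDuality.DigraphCode =>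
      BoundedHeightTreeDuality.HasBoundedHeightTreeDuality
        (BoundedHeightTreeDuality.decode c) := by
  open BoundedHeightTreeDuality in
  have hn : Primrec fun c : DigraphCode => c.1 := .fst
  have hm : Primrec fun c : DigraphCode => 2 * c.1 ^ (c.1 * c.1) :=
    Primrec.nat_mul.comp (.const 2) (primrec₂_pow.comp hn (Primrec.nat_mul.comp hn hn))
  refine (primrecPred_homTo_powerDigraph.and
    (primrecPred_homTo_expDigraph_directedPath hm)).of_eq fun c => ?_
  rw [hasBoundedHeightTreeDuality_iff_expDigraph, Nat.card_fin]

/-- The problem whether an input digraph has bounded-height tree duality is decidable. -/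
theorem corollary3p3 :
    ComputablePred fun c : BoundedHeightTreeDuality.DigraphCode =>
      BoundedHeightTreeDuality.HasBoundedHeightTreeDuality
        (BoundedHeightTreeDuality.decode c) :=
  corollary3p3_general.computablePred
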